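/- Theorem. Every lobster admits an antimagic orientation. Here all graphs are finite and simple. A leaf is a vertex of degree one. A caterpillar is a tree of order at least $3$ such that the removal of all its leaves produces a path (a single vertex counts as a path). A lobster is a tree such that the removal of all its leaves produces a caterpillar. An antimagic orientation of a graph $G$ with $m$ edges is a pair $(D,\tau)$, where $D$ is an orientation of $G$ with arc set $A(D)$ and $\tau : A(D)\to\{1,2,\dots,m\}$ is a bijection, such that no two distinct vertices have the same vertex-sum; the vertex-sum of a vertex $u$ is the sum of the labels of all arcs of $D$ entering $u$ minus the sum of the labels of all arcs of $D$ leaving $u$. -/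

import Mathlib

namespace AntimagicOrientation

variable {V : Type*}

/-- A leaf of a graph is a vertex of degree one. -/
def IsLeaf (G : SimpleGraph V) (v : V) : Prop :=
  (G.neighborSet v).ncard = 1

/-- The graph obtained from `G` by removing all its leaves. -/
def removeLeaves (G : SimpleGraph V) : SimpleGraph {v : V | ¬ IsLeaf G v} :=
  G.induce {v : V | ¬ IsLeaf G v}

/-- `G` is a (finite) path with at least one vertex; a single vertex is a path. -/
def IsPathGraph (G : SimpleGraph V) : Prop :=
  ∃ n : ℕ, Nonempty (G ≃g SimpleGraph.pathGraph (n + 1))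

/-- A caterpillar is a tree of order at least three such that the removal of its leaves
produces a path. -/
def IsCaterpillar (G : SimpleGraph V) : Prop :=
  G.IsTree ∧ 3 ≤ Nat.card V ∧ IsPathGraph (removeLeaves G)

/-- A lobster is a tree such that the removal of its leaves produces a caterpillar. -/
def IsLobster (G : SimpleGraph V) : Prop :=
  G.IsTree ∧ IsCaterpillar (removeLeaves G)

/-- `D` is an orientation of the simple graph `G`: every arc of `D` is along an edge of `G`, and
every edge of `G` carries exactly one of its two possible arcs. -/
def IsOrientation (D : Digraph V) (G : SimpleGraph V) : Prop :=
  (∀ u v, D.Adj u v → G.Adj u v) ∧ ∀ u v, G.Adj u v → Xor (D.Adj u v) (D.Adj v u)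

/-- The set of arcs of a digraph; the arc from `u` to `v` is the pair `(u, v)`. -/
def arcSet (D : Digraph V) : Set (V × V) :=
  {a | D.Adj a.1 a.2}

open Classical in
/-- The vertex-sum of `u`: the sum of the labels of all arcs entering `u` minus the sum of the
labels of all arcs leaving `u`. -/
noncomputable def vertexSum [Fintype V] (D : Digraph V) (τ : V × V → ℕ) (u : V) : ℤ :=
  (∑ w : V with D.Adj w u, (τ (w, u) : ℤ)) - (∑ w : V with D.Adj u w, (τ (u, w) : ℤ))

/-- An antimagic labeling of a digraph with `m` arcs: a bijection from the arcs to `{1, …, m}` such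
that no two vertices have the same vertex-sum. The values
of `τ` off the arc set are irrelevant. -/
def IsAntimagicLabeling [Fintype V] (D : Digraph V) (τ : V × V → ℕ) : Prop :=
  Set.BijOn τ (arcSet D) (Set.Icc 1 (arcSet D).ncard) ∧
    ∀ u v : V, u ≠ v → vertexSum D τ u ≠ vertexSum D τ v

/-- `G` admits an antimagic orientation. -/
def HasAntimagicOrientation [Fintype V] (G : SimpleGraph V) : Prop :=
  ∃ (D : Digraph V) (τ : V × V → ℕ), IsOrientation D G ∧ IsAntimagicLabeling D τ

end AntimagicOrientation

namespace AntimagicOrientation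

/-! The spine is the inner path of the caterpillar, prolonged at one end by a leaf of the
caterpillar; the tree is rooted at the other end. Let `Y` be the spine vertices carrying a branch of
length two, and `X` the other vertices with a child off the spine. All edges point to the root,
except that the off-spine edges below an `X` vertex point away from it. The labels come in
consecutive blocks: the `K` spine edges, the unselected leaf edges, one selected leaf edge per `X`
vertex, the unselected branch edges, one selected branch edge per `Y` vertex. This puts `Y` sums
above all leaf sums, `X` sums below all leaf sums, and bare spine vertices strictly within `K` of
zero, with leaf sums beyond `K` in absolute value. Inside each class: selected edges are labelled in
the order of the partial sums at their upper ends (`exists_sorted_labels`), leaf sums are signed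
distinct labels, and bare spine vertices get differences of distinct size (`exists_path_labels`). -/

/-! ### Greedy labelings of sets and of paths. -/

/-- Numbers increasing in the order of `f` can be attached to the elements of a finite set. -/
lemma exists_sorted_labels {α : Type*} (A : Finset α) (o : ℕ) (f : α → ℤ) :
    ∃ g : α → ℕ, (∀ a ∈ A, o < g a ∧ g a ≤ o + A.card) ∧ Set.InjOn g A ∧
      Set.InjOn (fun a => f a + g a) A := by
  classical
  -- The element with the largest `f` comes last and takes the largest label, so its value of `f +
  -- g` exceeds all earlier ones.
  induction A using Finset.induction_on_max_value f with
  | empty => exact ⟨fun _ => 0, by simp⟩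
  | insert a A ha hmax ih =>
    obtain ⟨g, h1, h2, h3⟩ := ih
    have hg : ∀ x ∈ A, Function.update g a (o + A.card + 1) x = g x := fun x hx =>
      Function.update_of_ne (ne_of_mem_of_not_mem hx ha) _ _
    have hga : Function.update g a (o + A.card + 1) a = o + A.card + 1 :=
      Function.update_self _ _ _
    refine ⟨Function.update g a (o + A.card + 1), ?_, ?_, ?_⟩
    · intro x hx
      rw [Finset.card_insert_of_notMem ha]
      rcases Finset.mem_insert.1 hx with rfl | hx
      · rw [hga]; omega
      · rw [hg x hx]; have := h1 x hx; omega
    · intro x hx y hy hxy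
      rcases Finset.mem_insert.1 (Finset.mem_coe.1 hx) with rfl | hx' <;>
      rcases Finset.mem_insert.1 (Finset.mem_coe.1 hy) with rfl | hy'
      · rfl
      · rw [hga, hg y hy'] at hxy; have := h1 y hy'; omega
      · rw [hga, hg x hx'] at hxy; have := h1 x hx'; omega
      · rw [hg y hy', hg x hx'] at hxy; exact h2 hx' hy' hxy
    · intro x hx y hy hxy
      simp only at hxy
      rcases Finset.mem_insert.1 (Finset.mem_coe.1 hx) with rfl | hx' <;>
      rcases Finset.mem_insert.1 (Finset.mem_coe.1 hy) with rfl | hy'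
      · rfl
      · rw [hga, hg y hy'] at hxy; have := h1 y hy'; have := hmax y hy'; omega
      · rw [hga, hg x hx'] at hxy; have := h1 x hx'; have := hmax x hx'; omega
      · rw [hg y hy', hg x hx'] at hxy; exact h3 hx' hy' hxy

/-- A sequence of bits satisfying prescriptions, each of which is either an explicit bit or the
demand to differ from the next bit. -/
lemma exists_bits (t : ℕ → Option Bool) (K : ℕ) :
    ∃ c : ℕ → Bool, ∀ i, i + 1 < K → c i = (t (i + 1)).getD (!c (i + 1)) := by
  -- Each bit depends on the next, so the recursion runs backwards: `d j` is bit `K - 1 - j`, and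
  -- the starting value `true` is arbitrary.
  let d : ℕ → Bool := fun j => Nat.rec true (fun j b => (t (K - 1 - j)).getD (!b)) j
  refine ⟨fun i => d (K - 1 - i), fun i hi => ?_⟩
  have h1 : K - 1 - i = (K - 1 - (i + 1)) + 1 := by omega
  have h2 : K - 1 - (K - 1 - (i + 1)) = i + 1 := by omega
  have h3 : d (K - 1 - i) = (t (K - 1 - (K - 1 - (i + 1)))).getD (!d (K - 1 - (i + 1))) := by
    rw [h1]
  simp only [h3, h2]

/-- Labels `1, …, K` along a path such that prescribed inner vertices see an ascent
(`some false`), a descent (`some true`), and at the other ones the differences are, up to sign,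
pairwise distinct. -/
lemma exists_path_labels (t : ℕ → Option Bool) (K : ℕ) :
    ∃ l : ℕ → ℕ, (∀ i < K, 1 ≤ l i ∧ l i ≤ K) ∧ (∀ i j, i < j → j < K → l i ≠ l j) ∧
      (∀ i, i + 1 < K → t (i + 1) = some true → l (i + 1) < l i) ∧
      (∀ i, i + 1 < K → t (i + 1) = some false → l i < l (i + 1)) ∧
      (∀ i, i + 1 < K → t (i + 1) = none →
        (l i : ℤ) - l (i + 1) = K - (i + 1) ∨ (l i : ℤ) - l (i + 1) = -(K - (i + 1))) := by
  obtain ⟨c, hc⟩ := exists_bits t K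
  -- `hi i` and `lo i` count the labels taken from the top and from the bottom before edge `i`. The
  -- unused ones form the interval from `lo i + 1` to `K - hi i`, and `c i` decides which end is
  -- taken next; all later labels lie on the other side.
  let hi : ℕ → ℕ := fun i => Nat.rec 0 (fun j n => n + (if c j then 1 else 0)) i
  let lo : ℕ → ℕ := fun i => Nat.rec 0 (fun j n => n + (if c j then 0 else 1)) i
  have hi_succ : ∀ i, hi (i + 1) = hi i + (if c i then 1 else 0) := fun _ => rfl
  have lo_succ : ∀ i, lo (i + 1) = lo i + (if c i then 0 else 1) := fun _ => rfl
  have hsum : ∀ i, lo i + hi i = i := by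
    intro i
    induction i with
    | zero => rfl
    | succ i ih => rw [hi_succ, lo_succ]; split_ifs <;> omega
  have hi_mono : Monotone hi := monotone_nat_of_le_succ fun i => by rw [hi_succ]; omega
  have lo_mono : Monotone lo := monotone_nat_of_le_succ fun i => by rw [lo_succ]; omega
  let l : ℕ → ℕ := fun i => if c i then K - hi i else lo i + 1
  have l_true : ∀ i, c i = true → l i = K - hi i := fun i h => by simp [l, h]
  have l_false : ∀ i, c i = false → l i = lo i + 1 := fun i h => by simp [l, h]
  have l_bd : ∀ i j, i ≤ j → j < K → lo i + 1 ≤ l j ∧ l j ≤ K - hi i := by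
    intro i j hij hj
    have := hi_mono hij
    have := lo_mono hij
    have := hsum j
    rcases h : c j with _ | _
    · rw [l_false j h]; omega
    · rw [l_true j h]; omega
  have l_desc : ∀ i j, i < j → j < K → c i = true → l j < l i := by
    intro i j hij hj h
    have h1 := l_bd (i + 1) j hij hj
    rw [hi_succ, if_pos h] at h1
    have := hsum i
    rw [l_true i h]; omega
  have l_asc : ∀ i j, i < j → j < K → c i = false → l i < l j := by
    intro i j hij hj h
    have h1 := l_bd (i + 1) j hij hj
    rw [lo_succ, h] at h1
    rw [l_false i h]; simpa using h1.1
  refine ⟨l, ?_, ?_, ?_, ?_, ?_⟩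
  · intro i hi'
    have := l_bd i i le_rfl hi'
    omega
  · intro i j hij hj
    rcases h : c i with _ | _
    · exact (l_asc i j hij hj h).ne
    · exact (l_desc i j hij hj h).ne'
  · intro i hi' ht
    exact l_desc i _ (Nat.lt_succ_self i) hi' (by rw [hc i hi', ht]; rfl)
  · intro i hi' ht
    exact l_asc i _ (Nat.lt_succ_self i) hi' (by rw [hc i hi', ht]; rfl)
  -- Opposite bits give edges `i` and `i + 1` the two ends of an interval of `K - i` labels.
  · intro i hi' ht
    have h1 := hc i hi'
    rw [ht] at h1
    have h2 := hsum i
    have h3 := hsum (i + 1)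
    rcases h : c (i + 1) with _ | _
    · have h4 : c i = true := by simpa [h] using h1
      left
      rw [l_true i h4, l_false _ h, lo_succ, if_pos h4]
      omega
    · have h4 : c i = false := by simpa [h] using h1
      right
      rw [l_false i h4, l_true _ h, hi_succ, h4]
      simp only [Bool.false_eq_true, if_false]
      omega

/-! ### From signs and labels on a rooted tree to an orientation. -/

open Classical in
/-- Summing over the neighbours of `u` that are children with `P` or, if `P u` fails, the parent. -/
lemma sum_children_add_parent {V : Type*} [Fintype V] (r : V) (par : V → V) (l : V → ℕ)
    (hlr : l r = 0) (u : V) (hno : ∀ w, w ≠ r → par w = u → u ≠ r → par u = w → False)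
    (P A : V → Prop) (f : V → ℕ)
    (hA : ∀ w, A w ↔ (w ≠ r ∧ par w = u ∧ P w) ∨ (u ≠ r ∧ par u = w ∧ ¬ P u))
    (hf1 : ∀ w, w ≠ r → par w = u → f w = l w) (hf2 : ∀ w, u ≠ r → par u = w → f w = l u) :
    (∑ w with A w, (f w : ℤ)) = (∑ c with c ≠ r ∧ par c = u, (if P c then (l c : ℤ) else 0)) +
      if P u then 0 else (l u : ℤ) := by
  have h : ∀ w, (if A w then (f w : ℤ) else 0) =
      (if w ≠ r ∧ par w = u then (if P w then (l w : ℤ) else 0) else 0) +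
        (if w = par u then (if P u then 0 else (l u : ℤ)) else 0) := by
    intro w
    have hn := hno w
    by_cases h1 : w ≠ r ∧ par w = u
    · have h2 : ¬ (u ≠ r ∧ par u = w) := fun h2 => hn h1.1 h1.2 h2.1 h2.2
      -- The root has no parent edge and `par r` is arbitrary; the label `0` removes that term.
      have h3 : (if w = par u then (if P u then 0 else (l u : ℤ)) else 0) = 0 := by
        by_cases h4 : u = r
        · rw [h4, hlr]; simp
        · rw [if_neg fun h => h2 ⟨h4, h.symm⟩]
      have h4 : A w ↔ P w := by rw [hA]; tauto
      rw [h3, if_pos h1, add_zero, hf1 w h1.1 h1.2]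
      simp only [h4]
    · rw [if_neg h1, zero_add]
      by_cases h2 : u ≠ r ∧ par u = w
      · have h4 : A w ↔ ¬ P u := by rw [hA]; tauto
        rw [if_pos h2.2.symm, hf2 w h2.1 h2.2]
        by_cases h5 : P u <;> simp [h4, h5]
      · have h4 : ¬ A w := by rw [hA]; tauto
        rw [if_neg h4]
        by_cases h5 : u = r
        · rw [h5, hlr]; simp
        · rw [if_neg fun h => h2 ⟨h5, h.symm⟩]
  rw [Finset.sum_filter, Finset.sum_congr rfl fun w _ => h w, Finset.sum_add_distrib,
    Finset.sum_ite_eq', Finset.sum_filter]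
  simp

open Classical in
/-- A graph all of whose edges join a vertex to its parent has an antimagic orientation as soon as
signs and labels of its edges (indexed by their lower ends) make the signed sums distinct. -/
theorem hasAntimagicOrientation_of_parent {V : Type*} [Fintype V] (T : SimpleGraph V) (r : V)
    (par : V → V) (d : V → ℕ) (hd : ∀ v, v ≠ r → d (par v) < d v)
    (hadj : ∀ a b, T.Adj a b ↔ (a ≠ r ∧ par a = b) ∨ (b ≠ r ∧ par b = a))
    (up : V → Prop) (l : V → ℕ) (hl : Function.Injective l) (hlr : l r = 0)
    (hlV : ∀ v, l v ≤ Fintype.card V - 1)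
    (hvs : Function.Injective fun u => (∑ c with c ≠ r ∧ par c = u, (if up c then (l c : ℤ) else -l c))
      - (if up u then (l u : ℤ) else -l u)) :
    HasAntimagicOrientation T := by
  have hno : ∀ a b, a ≠ r → par a = b → b ≠ r → par b = a → False := by
    intro a b ha hab hb hba
    have h1 := hd a ha
    have h2 := hd b hb
    rw [hab] at h1; rw [hba] at h2
    omega
  let D : Digraph V := ⟨fun a b => (a ≠ r ∧ par a = b ∧ up a) ∨ (b ≠ r ∧ par b = a ∧ ¬ up b)⟩
  have hD : ∀ a b, D.Adj a b ↔ (a ≠ r ∧ par a = b ∧ up a) ∨ (b ≠ r ∧ par b = a ∧ ¬ up b) :=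
    fun _ _ => Iff.rfl
  let τ : V × V → ℕ := fun x => if x.1 ≠ r ∧ par x.1 = x.2 then l x.1 else l x.2
  have hτ1 : ∀ a b, a ≠ r → par a = b → τ (a, b) = l a := fun a b h1 h2 => if_pos ⟨h1, h2⟩
  have hτ2 : ∀ a b, b ≠ r → par b = a → τ (a, b) = l b := fun a b h1 h2 =>
    if_neg fun h => hno a b h.1 h.2 h1 h2
  let φ : V → V × V := fun v => if up v then (v, par v) else (par v, v)
  have hτφ : ∀ v, v ≠ r → τ (φ v) = l v := by
    intro v hv
    by_cases h : up v
    · simp only [φ, if_pos h]; exact hτ1 _ _ hv rfl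
    · simp only [φ, if_neg h]; exact hτ2 _ _ hv rfl
  have hφ : arcSet D = φ '' {r}ᶜ := by
    ext ⟨a, b⟩
    simp only [arcSet, Set.mem_ofPred_eq, hD, Set.mem_image, Set.mem_compl_iff,
      Set.mem_singleton_iff]
    constructor
    · rintro (⟨h1, h2, h3⟩ | ⟨h1, h2, h3⟩)
      · exact ⟨a, h1, by simp [φ, h3, h2]⟩
      · exact ⟨b, h1, by simp [φ, h3, h2]⟩
    · rintro ⟨v, hv, hvab⟩
      by_cases h : up v
      · simp only [φ, if_pos h, Prod.mk.injEq] at hvab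
        obtain ⟨rfl, rfl⟩ := hvab
        exact Or.inl ⟨hv, rfl, h⟩
      · simp only [φ, if_neg h, Prod.mk.injEq] at hvab
        obtain ⟨rfl, rfl⟩ := hvab
        exact Or.inr ⟨hv, rfl, h⟩
  have hφinj : Set.InjOn φ {r}ᶜ := by
    intro a ha b hb hab
    apply hl
    rw [← hτφ a ha, ← hτφ b hb, hab]
  have hcardc : ({r}ᶜ : Set V).ncard = Fintype.card V - 1 := by
    rw [Set.ncard_compl, Set.ncard_singleton, Nat.card_eq_fintype_card]
  have hcard : (arcSet D).ncard = Fintype.card V - 1 := by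
    rw [hφ, hφinj.ncard_image, hcardc]
  have hlmaps : Set.MapsTo l {r}ᶜ (Set.Icc 1 (Fintype.card V - 1)) := by
    intro v hv
    refine ⟨Nat.one_le_iff_ne_zero.2 fun h => hv ?_, hlV v⟩
    exact hl (h.trans hlr.symm)
  -- An injection between finite sets of equal size is onto.
  have hlimage : l '' {r}ᶜ = Set.Icc 1 (Fintype.card V - 1) := by
    apply Set.eq_of_subset_of_ncard_le hlmaps.image_subset
    rw [Set.ncard_image_of_injective _ hl, hcardc, ← Nat.card_coe_set_eq]
    simp
  refine ⟨D, τ, ⟨?_, ?_⟩, ⟨?_, ?_, ?_⟩, ?_⟩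
  · intro u v h
    rw [hadj]
    rcases h with ⟨h1, h2, -⟩ | ⟨h1, h2, -⟩
    · exact Or.inl ⟨h1, h2⟩
    · exact Or.inr ⟨h1, h2⟩
  · intro u v h
    have hn := hno u v
    rw [hadj] at h
    rw [hD, hD, xor_def]
    tauto
  · rw [hcard, hφ]
    rintro _ ⟨v, hv, rfl⟩
    rw [hτφ v hv]
    exact hlmaps hv
  · rw [hφ]
    rintro _ ⟨v, hv, rfl⟩ _ ⟨w, hw, rfl⟩ h
    rw [hτφ v hv, hτφ w hw] at h
    rw [hl h]
  · rw [hcard, hφ, ← hlimage]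
    rintro _ ⟨v, hv, rfl⟩
    exact ⟨φ v, ⟨v, hv, rfl⟩, hτφ v hv⟩
  · have key : ∀ u, vertexSum D τ u = (∑ c with c ≠ r ∧ par c = u,
        (if up c then (l c : ℤ) else -l c)) - (if up u then (l u : ℤ) else -l u) := by
      intro u
      -- Entering arcs come from children with `up`, leaving arcs to children without it; the parent
      -- edge behaves the opposite way.
      have hin := sum_children_add_parent r par l hlr u (fun w => hno w u) up
        (fun w => D.Adj w u) (fun w => τ (w, u)) (fun w => hD w u) (fun w => hτ1 w u)
        (fun w => hτ2 w u)
      have hout := sum_children_add_parent r par l hlr u (fun w => hno w u) (fun w => ¬ up w)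
        (fun w => D.Adj u w) (fun w => τ (u, w))
        (fun w => by rw [hD, not_not, or_comm]) (fun w => hτ2 u w) (fun w => hτ1 u w)
      have hneg : (∑ c with c ≠ r ∧ par c = u, (if ¬ up c then (l c : ℤ) else 0)) =
          ∑ c with c ≠ r ∧ par c = u, (if up c then 0 else (l c : ℤ)) :=
        Finset.sum_congr rfl fun c _ => by by_cases h : up c <;> simp [h]
      have hs : (∑ c with c ≠ r ∧ par c = u, (if up c then (l c : ℤ) else -l c)) =
          (∑ c with c ≠ r ∧ par c = u, (if up c then (l c : ℤ) else 0)) -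
            (∑ c with c ≠ r ∧ par c = u, (if up c then 0 else (l c : ℤ))) := by
        rw [← Finset.sum_sub_distrib]
        exact Finset.sum_congr rfl fun c _ => by split_ifs <;> simp
      rw [vertexSum, hs]
      refine (congrArg₂ (· - ·) hin (hout.trans (congrArg₂ (· + ·)
        (?_ : _ = ∑ c with c ≠ r ∧ par c = u, (if up c then 0 else (l c : ℤ))) rfl))).trans ?_
      · convert hneg
      by_cases h : up u <;>
        simp only [h, not_true, not_false_iff, if_true, if_false] <;> ring
    intro u v huv h
    rw [key, key] at h
    exact huv (hvs h)

/-! ### Labeling a tree within distance two of its spine. -/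

set_option maxHeartbeats 2000000 in
open Classical in
/-- Edge signs and labels with distinct signed sums, for a rooted tree in which every vertex is
within distance two of a path `p 0, …, p K` climbing to the root `p K`, such that the vertices
hanging off `p 0` (there is at least one) are leaves while some vertex hanging off `p K` is not. -/
theorem exists_antimagic_labels {V : Type*} [Fintype V] (K : ℕ) (p : ℕ → V) (par : V → V)
    (idx : V → ℕ) (Sp : V → Prop) (hSp : ∀ v, Sp v ↔ ∃ i ≤ K, p i = v)
    (hidx : ∀ i ≤ K, idx (p i) = i) (hpar : ∀ i < K, par (p i) = p (i + 1))
    (hdepth : ∀ u c, ¬ Sp u → ¬ Sp c → par c = u → Sp (par u))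
    (hfirst : ∃ c, ¬ Sp c ∧ par c = p 0)
    (hfirst' : ∀ c, ¬ Sp c → par c = p 0 → ∀ d, ¬ Sp d → par d ≠ c)
    (hlast : ∃ w, ¬ Sp w ∧ par w = p K ∧ ∃ c, ¬ Sp c ∧ par c = w) :
    ∃ (up : V → Prop) (l : V → ℕ), Function.Injective l ∧ l (p K) = 0 ∧
      (∀ v, l v ≤ Fintype.card V - 1) ∧
      Function.Injective fun u =>
        (∑ c with c ≠ p K ∧ par c = u, (if up c then (l c : ℤ) else -l c)) -
          (if up u then (l u : ℤ) else -l u) := by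
  obtain ⟨W, hW⟩ : ∃ W : V → Prop, ∀ v, W v ↔ ¬ Sp v ∧ ∃ c, ¬ Sp c ∧ par c = v :=
    ⟨_, fun _ => Iff.rfl⟩
  obtain ⟨Y, hY⟩ : ∃ Y : V → Prop, ∀ v, Y v ↔ Sp v ∧ ∃ w, W w ∧ par w = v :=
    ⟨_, fun _ => Iff.rfl⟩
  obtain ⟨X, hX⟩ : ∃ X : V → Prop, ∀ v, X v ↔ ¬ Y v ∧ ∃ c, ¬ Sp c ∧ par c = v :=
    ⟨_, fun _ => Iff.rfl⟩
  have hSpp : ∀ i ≤ K, Sp (p i) := fun i hi => (hSp _).2 ⟨i, hi, rfl⟩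
  have W_ns : ∀ v, W v → ¬ Sp v := fun v h => ((hW v).1 h).1
  have Y_sp : ∀ v, Y v → Sp v := fun v h => ((hY v).1 h).1
  have X_nY : ∀ v, X v → ¬ Y v := fun v h => ((hX v).1 h).1
  have W_X : ∀ v, W v → X v := fun v h =>
    (hX v).2 ⟨fun h' => W_ns v h (Y_sp v h'), ((hW v).1 h).2⟩
  have X_W : ∀ v, X v → ¬ Sp v → W v := fun v h h' => (hW v).2 ⟨h', ((hX v).1 h).2⟩
  have par_YX : ∀ u, ¬ Sp u → ¬ X (par u) → Y (par u) := fun u h h' => by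
    by_contra h''
    exact h' ((hX _).2 ⟨h'', u, h, rfl⟩)
  have W_Y : ∀ w, W w → Y (par w) := fun w h => by
    obtain ⟨h1, c, hc, hcw⟩ := (hW w).1 h
    exact (hY _).2 ⟨hdepth w c h1 hc hcw, w, h, rfl⟩
  have X_child : ∀ c, X (par c) → ¬ W c := fun c h h' => X_nY _ h (W_Y c h')
  have X_first : X (p 0) := by
    refine (hX _).2 ⟨fun h => ?_, hfirst⟩
    obtain ⟨-, w, hw, hw0⟩ := (hY _).1 h
    obtain ⟨h1, c, hc, hcw⟩ := (hW w).1 hw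
    exact hfirst' w h1 hw0 c hc hcw
  have Y_last : Y (p K) := by
    obtain ⟨w, h1, h2, h3⟩ := hlast
    exact (hY _).2 ⟨hSpp K le_rfl, w, (hW w).2 ⟨h1, h3⟩, h2⟩
  have hK : 0 < K := by
    rcases Nat.eq_zero_or_pos K with h | h
    · subst h; exact absurd Y_last (X_nY _ X_first)
    · exact h
  -- `σ` selects the child whose edge will separate the sum at `v` from the others of its class;
  -- elsewhere its value is irrelevant.
  obtain ⟨σ, hσ⟩ : ∃ σ : V → V, ∀ v, (Y v → W (σ v) ∧ par (σ v) = v) ∧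
      (X v → ¬ Sp (σ v) ∧ par (σ v) = v) := by
    refine Classical.axiomOfChoice (r := fun v s => (Y v → W s ∧ par s = v) ∧
      (X v → ¬ Sp s ∧ par s = v)) fun v => ?_
    by_cases h1 : Y v
    · obtain ⟨-, w, hw⟩ := (hY v).1 h1
      exact ⟨w, fun _ => hw, fun h => absurd h1 (X_nY v h)⟩
    · by_cases h2 : X v
      · obtain ⟨-, w, hw⟩ := (hX v).1 h2
        exact ⟨w, fun h => absurd h h1, fun _ => hw⟩
      · exact ⟨v, fun h => absurd h h1, fun h => absurd h h2⟩
  -- the four groups of vertices off the spine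
  let G1 : Finset V := Finset.univ.filter fun u => ¬ Sp u ∧ ¬ W u ∧ σ (par u) ≠ u
  let G2 : Finset V := Finset.univ.filter fun u => ¬ Sp u ∧ ¬ W u ∧ σ (par u) = u
  let G3 : Finset V := Finset.univ.filter fun u => W u ∧ σ (par u) ≠ u
  let G4 : Finset V := Finset.univ.filter fun u => W u ∧ σ (par u) = u
  have mG1 : ∀ u, u ∈ G1 ↔ ¬ Sp u ∧ ¬ W u ∧ σ (par u) ≠ u := fun u => by simp [G1]
  have mG2 : ∀ u, u ∈ G2 ↔ ¬ Sp u ∧ ¬ W u ∧ σ (par u) = u := fun u => by simp [G2]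
  have mG3 : ∀ u, u ∈ G3 ↔ W u ∧ σ (par u) ≠ u := fun u => by simp [G3]
  have mG4 : ∀ u, u ∈ G4 ↔ W u ∧ σ (par u) = u := fun u => by simp [G4]
  -- The spine has `K + 1` vertices but uses only `K` positive labels, the root having label `0`.
  have hcard : (K + 1) + G1.card + G2.card + G3.card + G4.card = Fintype.card V := by
    have h1 : (Finset.univ.filter Sp).card = K + 1 := by
      have : Finset.univ.filter Sp = (Finset.range (K + 1)).image p := by
        ext v
        simp only [Finset.mem_filter, Finset.mem_univ, true_and, hSp, Finset.mem_image,
          Finset.mem_range, Nat.lt_succ_iff]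
      rw [this, Finset.card_image_of_injOn, Finset.card_range]
      intro i hi j hj hij
      have hi' : i ≤ K := by simpa [Nat.lt_succ_iff] using hi
      have hj' : j ≤ K := by simpa [Nat.lt_succ_iff] using hj
      rw [← hidx i hi', ← hidx j hj', hij]
    rw [← h1, ← Finset.card_univ, Finset.card_eq_sum_ones Finset.univ]
    simp only [G1, G2, G3, G4, Finset.card_filter, ← Finset.sum_add_distrib]
    refine Finset.sum_congr rfl fun v _ => ?_
    by_cases h1 : Sp v
    · have h2 : ¬ W v := fun h => W_ns v h h1
      simp [h1, h2]
    · by_cases h2 : W v <;> by_cases h3 : σ (par v) = v <;> simp [h1, h2, h3]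
  obtain ⟨n1, hn1⟩ : ∃ n, n = G1.card := ⟨_, rfl⟩
  obtain ⟨n2, hn2⟩ : ∃ n, n = G2.card := ⟨_, rfl⟩
  obtain ⟨n3, hn3⟩ : ∃ n, n = G3.card := ⟨_, rfl⟩
  obtain ⟨n4, hn4⟩ : ∃ n, n = G4.card := ⟨_, rfl⟩
  rw [← hn1, ← hn2, ← hn3, ← hn4] at hcard
  -- the labels
  obtain ⟨lp, lp_bd, lp_ne, lp_Y, lp_X, lp_Z⟩ := exists_path_labels
    (fun i => if Y (p i) then some true else if X (p i) then some false else none) K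
  obtain ⟨lam, hlam⟩ : ∃ lam : V → ℕ, ∀ v, lam v = if idx v < K then lp (idx v) else 0 :=
    ⟨_, fun _ => rfl⟩
  have lam_p : ∀ i < K, lam (p i) = lp i := fun i hi => by
    rw [hlam, hidx i hi.le, if_pos hi]
  have lam_last : lam (p K) = 0 := by rw [hlam, hidx K le_rfl, if_neg (lt_irrefl K)]
  let N : V → Finset V := fun v => Finset.univ.filter fun c => ¬ Sp c ∧ par c = v
  have mN : ∀ v c, c ∈ N v ↔ ¬ Sp c ∧ par c = v := fun v c => by simp [N]
  let B : V → ℤ := fun v => ∑ c with Sp c ∧ c ≠ p K ∧ par c = v, (lam c : ℤ)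
  obtain ⟨g1, g1_bd, g1_inj, -⟩ := exists_sorted_labels G1 K fun _ => 0
  obtain ⟨g3, g3_bd, g3_inj, -⟩ := exists_sorted_labels G3 (K + n1 + n2) fun _ => 0
  -- The choice does not follow the order of the blocks: sums at `Y` involve no `G2` label, so `G4`
  -- is settled first; sums at `X` involve the edge above a `W` vertex, so `G2` comes last. `l0` and
  -- `l1` are already correct on the terms of `f4` and `f2`.
  let l0 : V → ℕ := fun v => if W v then g3 v else g1 v
  let f4 : V → ℤ := fun w => ∑ c ∈ (N (par w)).erase w, (l0 c : ℤ) + (B (par w) - lam (par w))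
  obtain ⟨g4, g4_bd, g4_inj, g4_sum⟩ := exists_sorted_labels G4 (K + n1 + n2 + n3) f4
  let l1 : V → ℕ := fun v => if Sp v then lam v else
    if W v then (if σ (par v) = v then g4 v else g3 v) else g1 v
  let f2 : V → ℤ := fun x => ∑ c ∈ (N (par x)).erase x, (l1 c : ℤ) + (l1 (par x) - B (par x))
  obtain ⟨g2, g2_bd, g2_inj, g2_sum⟩ := exists_sorted_labels G2 (K + n1) f2
  rw [← hn1] at g1_bd
  rw [← hn2] at g2_bd
  rw [← hn3] at g3_bd
  rw [← hn4] at g4_bd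
  obtain ⟨l, hl⟩ : ∃ l : V → ℕ, ∀ v, l v = if Sp v then lam v else
      if W v then (if σ (par v) = v then g4 v else g3 v) else
        (if σ (par v) = v then g2 v else g1 v) := ⟨_, fun _ => rfl⟩
  have l_sp : ∀ v, Sp v → l v = lam v := fun v h => by rw [hl, if_pos h]
  have l_G1 : ∀ v ∈ G1, l v = g1 v := fun v h => by
    rw [mG1] at h; rw [hl, if_neg h.1, if_neg h.2.1, if_neg h.2.2]
  have l_G2 : ∀ v ∈ G2, l v = g2 v := fun v h => by
    rw [mG2] at h; rw [hl, if_neg h.1, if_neg h.2.1, if_pos h.2.2]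
  have l_G3 : ∀ v ∈ G3, l v = g3 v := fun v h => by
    rw [mG3] at h; rw [hl, if_neg (W_ns v h.1), if_pos h.1, if_neg h.2]
  have l_G4 : ∀ v ∈ G4, l v = g4 v := fun v h => by
    rw [mG4] at h; rw [hl, if_neg (W_ns v h.1), if_pos h.1, if_pos h.2]
  have l_cases : ∀ v, (∃ i < K, p i = v ∧ l v = lp i ∧ 1 ≤ lp i ∧ lp i ≤ K) ∨
      (v = p K ∧ l v = 0) ∨
      (v ∈ G1 ∧ K < l v ∧ l v ≤ K + n1) ∨ (v ∈ G2 ∧ K + n1 < l v ∧ l v ≤ K + n1 + n2) ∨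
      (v ∈ G3 ∧ K + n1 + n2 < l v ∧ l v ≤ K + n1 + n2 + n3) ∨
      (v ∈ G4 ∧ K + n1 + n2 + n3 < l v ∧ l v ≤ K + n1 + n2 + n3 + n4) := by
    intro v
    by_cases h1 : Sp v
    · obtain ⟨i, hi, rfl⟩ := (hSp v).1 h1
      rcases hi.lt_or_eq with hi | rfl
      · exact Or.inl ⟨i, hi, rfl, (l_sp _ h1).trans (lam_p i hi), lp_bd i hi⟩
      · exact Or.inr (Or.inl ⟨rfl, (l_sp _ h1).trans lam_last⟩)
    · refine Or.inr (Or.inr ?_)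
      by_cases h2 : W v <;> by_cases h3 : σ (par v) = v
      · have h := (mG4 v).2 ⟨h2, h3⟩
        exact Or.inr (Or.inr (Or.inr ⟨h, by rw [l_G4 v h]; exact g4_bd v h⟩))
      · have h := (mG3 v).2 ⟨h2, h3⟩
        exact Or.inr (Or.inr (Or.inl ⟨h, by rw [l_G3 v h]; exact g3_bd v h⟩))
      · have h := (mG2 v).2 ⟨h1, h2, h3⟩
        exact Or.inr (Or.inl ⟨h, by rw [l_G2 v h]; exact g2_bd v h⟩)
      · have h := (mG1 v).2 ⟨h1, h2, h3⟩
        exact Or.inl ⟨h, by rw [l_G1 v h]; exact g1_bd v h⟩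
  have l_inj : Function.Injective l := by
    intro u v huv
    rcases l_cases u with ⟨i, hi, hu, hu'⟩ | ⟨hu, hu'⟩ | ⟨hu, hu'⟩ | ⟨hu, hu'⟩ | ⟨hu, hu'⟩ |
      ⟨hu, hu'⟩ <;>
    rcases l_cases v with ⟨j, hj, hv, hv'⟩ | ⟨hv, hv'⟩ | ⟨hv, hv'⟩ | ⟨hv, hv'⟩ | ⟨hv, hv'⟩ |
      ⟨hv, hv'⟩ <;>
    first
    | omega
    | skip
    · rw [← hu, ← hv]
      rcases lt_trichotomy i j with h | h | h
      · have := lp_ne i j h hj; omega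
      · rw [h]
      · have := lp_ne j i h hi; omega
    · rw [hu, hv]
    · rw [l_G1 u hu, l_G1 v hv] at huv; exact g1_inj hu hv huv
    · rw [l_G2 u hu, l_G2 v hv] at huv; exact g2_inj hu hv huv
    · rw [l_G3 u hu, l_G3 v hv] at huv; exact g3_inj hu hv huv
    · rw [l_G4 u hu, l_G4 v hv] at huv; exact g4_inj hu hv huv
  have l_le : ∀ v, l v ≤ Fintype.card V - 1 := by
    intro v
    rcases l_cases v with ⟨i, hi, hu, hu'⟩ | ⟨hu, hu'⟩ | ⟨hu, hu'⟩ | ⟨hu, hu'⟩ | ⟨hu, hu'⟩ |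
      ⟨hu, hu'⟩ <;> omega
  -- the contributions of spine edges
  have par_sp : ∀ c, Sp c → c ≠ p K → ∃ i < K, c = p i ∧ par c = p (i + 1) := by
    intro c hc hcK
    obtain ⟨i, hi, rfl⟩ := (hSp c).1 hc
    have hi' : i < K := lt_of_le_of_ne hi fun h => hcK (by rw [h])
    exact ⟨i, hi', rfl, hpar i hi'⟩
  have B_ns : ∀ v, ¬ Sp v → B v = 0 := by
    intro v hv
    refine Finset.sum_eq_zero fun c hc => ?_
    obtain ⟨h1, h2, h3⟩ := (Finset.mem_filter.1 hc).2
    obtain ⟨i, hi, -, h4⟩ := par_sp c h1 h2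
    exact absurd (hSpp (i + 1) hi) (by rw [← h4, h3]; exact hv)
  have B_first : B (p 0) = 0 := by
    refine Finset.sum_eq_zero fun c hc => ?_
    obtain ⟨h1, h2, h3⟩ := (Finset.mem_filter.1 hc).2
    obtain ⟨i, hi, -, h4⟩ := par_sp c h1 h2
    have h5 := hidx (i + 1) hi
    rw [← h4, h3, hidx 0 hK.le] at h5
    omega
  have B_succ : ∀ i < K, B (p (i + 1)) = lp i := by
    intro i hi
    have : (Finset.univ.filter fun c => Sp c ∧ c ≠ p K ∧ par c = p (i + 1)) = {p i} := by
      ext c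
      simp only [Finset.mem_filter, Finset.mem_univ, true_and, Finset.mem_singleton]
      constructor
      · rintro ⟨h1, h2, h3⟩
        obtain ⟨j, hj, h4, h5⟩ := par_sp c h1 h2
        have h6 := hidx (j + 1) hj
        rw [← h5, h3, hidx (i + 1) hi] at h6
        rw [h4, Nat.succ_injective h6]
      · rintro rfl
        refine ⟨hSpp i hi.le, fun h => ?_, hpar i hi⟩
        have h6 := hidx i hi.le
        rw [h, hidx K le_rfl] at h6
        omega
    simp only [B, this, Finset.sum_singleton, lam_p i hi]
  -- The ends matter here: `p 0` has no spine edge entering and is not in `Y`; the root has none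
  -- leaving and is not in `X`.
  have Y_pos : ∀ v, Y v → 1 ≤ B v - lam v := by
    intro v hv
    obtain ⟨i, hi, rfl⟩ := (hSp v).1 (Y_sp v hv)
    rcases i with _ | i
    · exact absurd hv (X_nY _ X_first)
    · rw [B_succ i hi]
      have := lp_bd i hi
      rcases hi.lt_or_eq with hi' | hi'
      · have := lp_Y i hi' (by rw [if_pos hv])
        rw [lam_p _ hi']; omega
      · rw [hi', lam_last]; omega
  have X_pos : ∀ v, X v → 1 ≤ l v - B v := by
    intro v hv
    by_cases h : Sp v
    · rw [l_sp v h]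
      obtain ⟨i, hi, rfl⟩ := (hSp v).1 h
      rcases hi.lt_or_eq with hi' | rfl
      · rw [lam_p _ hi']
        rcases i with _ | i
        · rw [B_first]; have := lp_bd 0 hi'; omega
        · rw [B_succ i hi]
          have := lp_X i hi' (by rw [if_neg (X_nY _ hv), if_pos hv])
          omega
      · exact absurd Y_last (X_nY _ hv)
    · rw [B_ns v h]
      rcases l_cases v with ⟨i, hi, hu, hu'⟩ | ⟨hu, hu'⟩ | hu | hu | hu | hu
      · exact absurd (hSpp i hi.le) (hu ▸ h)
      · exact absurd (hSpp K le_rfl) (hu ▸ h)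
      all_goals omega
  -- the vertex sums
  obtain ⟨up, up_iff⟩ : ∃ up : V → Prop, ∀ v, up v ↔ ¬ (¬ Sp v ∧ X (par v)) :=
    ⟨_, fun _ => Iff.rfl⟩
  obtain ⟨vs, hvs⟩ : ∃ vs : V → ℤ, ∀ u, vs u =
      (∑ c with c ≠ p K ∧ par c = u, (if up c then (l c : ℤ) else -l c)) -
        (if up u then (l u : ℤ) else -l u) := ⟨_, fun _ => rfl⟩
  have up_sp : ∀ v, Sp v → up v := fun v h => (up_iff v).2 fun h' => h'.1 h
  have vs_eq : ∀ u, vs u = (∑ c ∈ N u, (if up c then (l c : ℤ) else -l c)) + B u -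
      (if up u then (l u : ℤ) else -l u) := by
    intro u
    rw [hvs]
    congr 1
    simp only [N, B, Finset.sum_filter, ← Finset.sum_add_distrib]
    refine Finset.sum_congr rfl fun c _ => ?_
    by_cases h : Sp c
    · simp [h, up_sp c h, l_sp c h]
    · have : c ≠ p K := fun h' => h (h' ▸ hSpp K le_rfl)
      simp [h, this]
  have vs_Y : ∀ v, Y v → vs v = f4 (σ v) + g4 (σ v) ∧ σ v ∈ G4 := by
    intro v hv
    obtain ⟨h1, h2⟩ := (hσ v).1 hv
    have hm : σ v ∈ N v := (mN _ _).2 ⟨W_ns _ h1, h2⟩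
    have hG : σ v ∈ G4 := (mG4 _).2 ⟨h1, by rw [h2]⟩
    refine ⟨?_, hG⟩
    have hs : (∑ c ∈ N v, (if up c then (l c : ℤ) else -l c)) =
        ∑ c ∈ (N v).erase (σ v), (l0 c : ℤ) + g4 (σ v) := by
      rw [← Finset.sum_erase_add _ _ hm]
      have hup : ∀ c ∈ N v, up c := fun c hc => (up_iff c).2 fun h => by
        rw [((mN v c).1 hc).2] at h
        exact X_nY v h.2 hv
      congr 1
      · refine Finset.sum_congr rfl fun c hc => ?_
        obtain ⟨hc1, hc2⟩ := Finset.mem_erase.1 hc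
        obtain ⟨hc3, hc4⟩ := (mN v c).1 hc2
        have hc5 : σ (par c) ≠ c := by rw [hc4]; exact hc1.symm
        rw [if_pos (hup c hc2), hl, if_neg hc3, if_neg hc5, if_neg hc5]
      · rw [if_pos (hup _ hm), l_G4 _ hG]
    rw [vs_eq, hs, if_pos (up_sp v (Y_sp v hv)), l_sp v (Y_sp v hv)]
    simp only [f4, h2]
    ring
  have vs_X : ∀ v, X v → vs v = -(f2 (σ v) + g2 (σ v)) ∧ σ v ∈ G2 := by
    intro v hv
    obtain ⟨h1, h2⟩ := (hσ v).2 hv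
    have hm : σ v ∈ N v := (mN _ _).2 ⟨h1, h2⟩
    have hG : σ v ∈ G2 := (mG2 _).2 ⟨h1, X_child _ (by rw [h2]; exact hv), by rw [h2]⟩
    refine ⟨?_, hG⟩
    have hs : (∑ c ∈ N v, (if up c then (l c : ℤ) else -l c)) =
        -(∑ c ∈ (N v).erase (σ v), (l1 c : ℤ) + g2 (σ v)) := by
      rw [← Finset.sum_erase_add _ _ hm, neg_add, ← Finset.sum_neg_distrib]
      have hup : ∀ c ∈ N v, ¬ up c := fun c hc h => by
        obtain ⟨hc1, hc2⟩ := (mN v c).1 hc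
        exact (up_iff c).1 h ⟨hc1, by rw [hc2]; exact hv⟩
      congr 1
      · refine Finset.sum_congr rfl fun c hc => ?_
        obtain ⟨hc1, hc2⟩ := Finset.mem_erase.1 hc
        obtain ⟨hc3, hc4⟩ := (mN v c).1 hc2
        have hc5 : σ (par c) ≠ c := by rw [hc4]; exact hc1.symm
        rw [if_neg (hup c hc2), hl]
        simp only [l1, if_neg hc3, if_neg hc5]
      · rw [if_neg (hup _ hm), l_G2 _ hG]
    have hup : up v := (up_iff v).2 fun h => X_child v h.2 (X_W v hv h.1)
    have hl1 : l1 v = l v := by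
      rw [hl]
      by_cases h : Sp v
      · simp only [l1, if_pos h]
      · simp only [l1, if_neg h, if_pos (X_W v hv h)]
    rw [vs_eq, hs, if_pos hup]
    simp only [f2, h2, hl1]
    ring
  have vs_leaf : ∀ v, ¬ Sp v → ¬ W v → vs v = -(if up v then (l v : ℤ) else -l v) := by
    intro v h1 h2
    have : N v = ∅ := by
      refine Finset.eq_empty_of_forall_notMem fun c hc => h2 ((hW v).2 ⟨h1, c, ?_⟩)
      exact (mN v c).1 hc
    rw [vs_eq, this, B_ns v h1, Finset.sum_empty]
    ring
  -- These five ranges are pairwise disjoint. A leaf below a `Y` vertex is never selected, which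
  -- keeps its sum at least `-(K + n1)`.
  have vs_cases : ∀ v, (Y v ∧ (K + n1 + n2 : ℤ) < vs v) ∨ (X v ∧ vs v < -(K + n1 : ℤ)) ∨
      (vs v = l v ∧ (K : ℤ) < l v ∧ (l v : ℤ) ≤ K + n1 + n2) ∨
      (vs v = -l v ∧ (K : ℤ) < l v ∧ (l v : ℤ) ≤ K + n1) ∨
      (∃ i < K, v = p i ∧ (vs v = K - i ∨ vs v = -(K - i))) := by
    intro v
    by_cases hv : Y v
    · left
      obtain ⟨h1, h2⟩ := vs_Y v hv
      have h3 := g4_bd _ h2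
      have h4 := Y_pos v hv
      have h5 : 0 ≤ ∑ c ∈ (N v).erase (σ v), (l0 c : ℤ) :=
        Finset.sum_nonneg fun c _ => Int.natCast_nonneg _
      simp only [f4, ((hσ v).1 hv).2] at h1
      refine ⟨hv, ?_⟩
      omega
    by_cases hv' : X v
    · right; left
      obtain ⟨h1, h2⟩ := vs_X v hv'
      have h3 := g2_bd _ h2
      have h4 := X_pos v hv'
      have h5 : 0 ≤ ∑ c ∈ (N v).erase (σ v), (l1 c : ℤ) :=
        Finset.sum_nonneg fun c _ => Int.natCast_nonneg _
      have hl1 : l1 v = l v := by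
        rw [hl]
        by_cases h : Sp v
        · simp only [l1, if_pos h]
        · simp only [l1, if_neg h, if_pos (X_W v hv' h)]
      simp only [f2, ((hσ v).2 hv').2, hl1] at h1
      refine ⟨hv', ?_⟩
      omega
    by_cases h1 : Sp v
    · right; right; right; right
      obtain ⟨i, hi, rfl⟩ := (hSp v).1 h1
      rcases i with _ | i
      · exact absurd X_first hv'
      have hi' : i + 1 < K := lt_of_le_of_ne hi fun h => hv (by rw [h]; exact Y_last)
      refine ⟨i + 1, hi', rfl, ?_⟩
      have hN : N (p (i + 1)) = ∅ := by
        refine Finset.eq_empty_of_forall_notMem fun c hc => hv' ((hX _).2 ⟨hv, c, ?_⟩)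
        exact (mN _ c).1 hc
      rw [vs_eq, hN, Finset.sum_empty, if_pos (up_sp _ h1), B_succ i hi, l_sp _ h1, lam_p _ hi',
        zero_add]
      have := lp_Z i hi' (by rw [if_neg hv, if_neg hv'])
      push_cast
      exact this
    · right; right
      have h2 : ¬ W v := fun h => hv' (W_X v h)
      have h3 := vs_leaf v h1 h2
      by_cases h4 : up v
      · right; left
        rw [if_pos h4] at h3
        have h5 : Y (par v) := par_YX v h1 fun h => (up_iff v).1 h4 ⟨h1, h⟩
        have h6 : v ∈ G1 := (mG1 v).2 ⟨h1, h2, fun h => h2 (h ▸ ((hσ _).1 h5).1)⟩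
        have h7 := g1_bd v h6
        rw [← l_G1 v h6] at h7
        exact ⟨h3, by omega, by omega⟩
      · left
        rw [if_neg h4, neg_neg] at h3
        refine ⟨h3, ?_⟩
        by_cases h5 : σ (par v) = v
        · have h6 : v ∈ G2 := (mG2 v).2 ⟨h1, h2, h5⟩
          have h7 := g2_bd v h6
          rw [← l_G2 v h6] at h7
          omega
        · have h6 : v ∈ G1 := (mG1 v).2 ⟨h1, h2, h5⟩
          have h7 := g1_bd v h6
          rw [← l_G1 v h6] at h7
          omega
  refine ⟨up, l, l_inj, (l_sp _ (hSpp K le_rfl)).trans lam_last, l_le, ?_⟩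
  have vs_inj : Function.Injective vs := by
    intro u v huv
    rcases vs_cases u with ⟨hu, hu'⟩ | ⟨hu, hu'⟩ | hu | hu | ⟨i, hi, hu, hu'⟩ <;>
    rcases vs_cases v with ⟨hv, hv'⟩ | ⟨hv, hv'⟩ | hv | hv | ⟨j, hj, hv, hv'⟩ <;>
    first
    | omega
    | skip
    -- Equal sums force equal selected children, hence equal parents.
    · obtain ⟨h1, h2⟩ := vs_Y u hu
      obtain ⟨h3, h4⟩ := vs_Y v hv
      have h5 : σ u = σ v := g4_sum h2 h4 (by simp only; rw [← h1, ← h3, huv])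
      rw [← ((hσ u).1 hu).2, h5, ((hσ v).1 hv).2]
    · obtain ⟨h1, h2⟩ := vs_X u hu
      obtain ⟨h3, h4⟩ := vs_X v hv
      have h5 : σ u = σ v := g2_sum h2 h4 (by simp only; rw [← neg_inj, ← h1, ← h3, huv])
      rw [← ((hσ u).2 hu).2, h5, ((hσ v).2 hv).2]
    · exact l_inj (by omega)
    · exact l_inj (by omega)
    · have : i = j := by omega
      rw [hu, hv, this]
  have : vs = _ := funext hvs
  rwa [this] at vs_inj

/-! ### The layers of a lobster. -/

/-- In a connected graph of order at least three, the only neighbour of a leaf is not a leaf. -/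
lemma IsLeaf.exists_neighbor {V : Type*} [Finite V] {G : SimpleGraph V} (hG : G.Connected)
    (h3 : 3 ≤ Nat.card V) {v : V} (hv : IsLeaf G v) :
    ∃ u, ¬ IsLeaf G u ∧ ∀ w, G.Adj v w ↔ w = u := by
  obtain ⟨u, hu⟩ := Set.ncard_eq_one.1 hv
  have hvu : ∀ w, G.Adj v w ↔ w = u := fun w => by
    rw [← SimpleGraph.mem_neighborSet, hu, Set.mem_singleton_iff]
  refine ⟨u, fun hu' => ?_, hvu⟩
  obtain ⟨x, hx⟩ := Set.ncard_eq_one.1 hu'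
  have hux : ∀ w, G.Adj u w ↔ w = x := fun w => by
    rw [← SimpleGraph.mem_neighborSet, hx, Set.mem_singleton_iff]
  have hxv : v = x := (hux v).1 ((hvu u).2 rfl).symm
  -- Two adjacent leaves would form a whole component.
  have hall : ∀ w, w = v ∨ w = u := by
    intro w
    have h := hG.preconnected v w
    rw [SimpleGraph.reachable_iff_reflTransGen] at h
    induction h with
    | refl => exact Or.inl rfl
    | tail _ hbc ih =>
      rcases ih with rfl | rfl
      · exact Or.inr ((hvu _).1 hbc)
      · exact Or.inl (((hux _).1 hbc).trans hxv.symm)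
  have h2 : (Set.univ : Set V) ⊆ {v, u} := fun w _ => hall w
  have h4 := Set.ncard_le_ncard h2
  have h5 := Set.ncard_insert_le v {u}
  rw [Set.ncard_univ] at h4
  rw [Set.ncard_singleton] at h5
  omega

/-- In a connected nontrivial graph, a vertex that is not a leaf has two neighbours. -/
lemma exists_two_neighbors {V : Type*} [Finite V] [Nontrivial V] {G : SimpleGraph V}
    (hG : G.Connected) {v : V} (hv : ¬ IsLeaf G v) :
    ∃ a b, a ≠ b ∧ G.Adj v a ∧ G.Adj v b := by
  have h0 : (G.neighborSet v).Nonempty :=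
    hG.preconnected.exists_adj_of_nontrivial v
  have h1 : (G.neighborSet v).ncard ≠ 1 := hv
  have h2 := (Set.ncard_pos (Set.toFinite _)).2 h0
  obtain ⟨a, ha, b, hb, hab⟩ := (Set.one_lt_ncard (Set.toFinite _)).1
    (show 1 < (G.neighborSet v).ncard by omega)
  exact ⟨a, b, hab, ha, hb⟩

/-- The vertices of a lobster are leaves (`L`), leaves of the caterpillar (`M`), or lie on a path
`q 0, …, q n`, both ends of which have neighbours in `M`. -/
theorem IsLobster.exists_layers {V : Type*} [Finite V] {T : SimpleGraph V} (hT : IsLobster T) :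
    ∃ (L M : V → Prop) (n : ℕ) (q : ℕ → V),
      (∀ v, L v ∨ M v ∨ ∃ i ≤ n, q i = v) ∧ (∀ v, M v → ¬ L v) ∧ (∀ i ≤ n, ¬ L (q i)) ∧
      (∀ i ≤ n, ¬ M (q i)) ∧ (∀ i ≤ n, ∀ j ≤ n, q i = q j → i = j) ∧
      (∀ i ≤ n, ∀ j ≤ n, T.Adj (q i) (q j) ↔ i + 1 = j ∨ j + 1 = i) ∧
      (∀ v, L v → ∃ u, ¬ L u ∧ ∀ w, T.Adj v w ↔ w = u) ∧
      (∀ v, M v → ∃ i ≤ n, ∀ w, ¬ L w → (T.Adj v w ↔ w = q i)) ∧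
      (∀ v, M v → ∃ c, L c ∧ T.Adj c v) ∧
      ∃ a b, a ≠ b ∧ M a ∧ M b ∧ T.Adj a (q 0) ∧ T.Adj b (q n) := by
  obtain ⟨hTt, hHt, hcard, n, ⟨φ⟩⟩ := hT
  set H := removeLeaves T
  have hHadj : ∀ x y, H.Adj x y ↔ T.Adj x.1 y.1 := fun x y => Iff.rfl
  have hcardV : 3 ≤ Nat.card V :=
    hcard.trans (Nat.card_le_card_of_injective _ Subtype.val_injective)
  have hV : Nontrivial V := Finite.one_lt_card_iff_nontrivial.1 (by omega)
  have hV' : Nontrivial {v : V | ¬ IsLeaf T v} :=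
    Finite.one_lt_card_iff_nontrivial.1 (by omega)
  let q' : Fin (n + 1) → {v : V | ¬ IsLeaf T v} := fun i => (φ.symm i).1
  have q'_leaf : ∀ i, ¬ IsLeaf H (q' i) := fun i => (φ.symm i).2
  have q'_inj : Function.Injective q' := Subtype.val_injective.comp φ.symm.injective
  have q'_surj : ∀ x, ¬ IsLeaf H x → ∃ i, q' i = x := fun x hx =>
    ⟨φ ⟨x, hx⟩, by simp [q']⟩
  have q'_adj : ∀ i j, H.Adj (q' i) (q' j) ↔ i.val + 1 = j.val ∨ j.val + 1 = i.val := by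
    intro i j
    rw [← SimpleGraph.pathGraph_adj, ← φ.symm.map_adj_iff]
    rfl
  let q : ℕ → V := fun i => (q' (Fin.ofNat (n + 1) i)).1
  have hq : ∀ i (hi : i ≤ n), q i = (q' ⟨i, Nat.lt_succ_of_le hi⟩).1 := by
    intro i hi
    have : Fin.ofNat (n + 1) i = ⟨i, Nat.lt_succ_of_le hi⟩ :=
      Fin.ext (Nat.mod_eq_of_lt (Nat.lt_succ_of_le hi))
    simp only [q, this]
  have hM : ∀ x, IsLeaf H x → ∃ i, ∀ w, H.Adj x w ↔ w = q' i := by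
    intro x hx
    obtain ⟨u, hu, hu'⟩ := hx.exists_neighbor hHt.connected hcard
    obtain ⟨i, rfl⟩ := q'_surj u hu
    exact ⟨i, hu'⟩
  -- An end of the path has at most one neighbor on it, so another neighbor is a leaf of `H`.
  have key : ∀ i : Fin (n + 1), (i.val = 0 ∨ i.val = n) → n ≠ 0 →
      ∃ a, IsLeaf H a ∧ H.Adj a (q' i) := by
    intro i hi hn
    obtain ⟨a, b, hab, ha, hb⟩ := exists_two_neighbors hHt.connected (q'_leaf i)
    by_contra! hcon
    obtain ⟨j, rfl⟩ := q'_surj a fun h => hcon a h ha.symm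
    obtain ⟨k, rfl⟩ := q'_surj b fun h => hcon b h hb.symm
    rw [q'_adj] at ha hb
    apply hab
    congr 1
    ext
    have := j.isLt
    have := k.isLt
    omega
  have ends : ∃ a b, a ≠ b ∧ IsLeaf H a ∧ IsLeaf H b ∧ H.Adj a (q' 0) ∧
      H.Adj b (q' (Fin.last n)) := by
    rcases Nat.eq_zero_or_pos n with rfl | hn
    · obtain ⟨a, b, hab, ha, hb⟩ := exists_two_neighbors hHt.connected (q'_leaf 0)
      have hl : ∀ x, H.Adj (q' 0) x → IsLeaf H x := by
        intro x hx
        by_contra h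
        obtain ⟨j, rfl⟩ := q'_surj x h
        rw [q'_adj] at hx
        have := j.isLt
        simp only [Fin.val_zero] at hx
        omega
      exact ⟨a, b, hab, hl a ha, hl b hb, ha.symm, hb.symm⟩
    · obtain ⟨a, ha, ha'⟩ := key 0 (Or.inl rfl) hn.ne'
      obtain ⟨b, hb, hb'⟩ := key (Fin.last n) (Or.inr rfl) hn.ne'
      refine ⟨a, b, ?_, ha, hb, ha', hb'⟩
      rintro rfl
      obtain ⟨i, hi⟩ := hM a ha
      have h1 := q'_inj (((hi _).1 ha').trans ((hi _).1 hb').symm)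
      have h2 := congrArg Fin.val h1
      simp only [Fin.val_zero, Fin.val_last] at h2
      omega
  refine ⟨IsLeaf T, fun v => ∃ h : ¬ IsLeaf T v, IsLeaf H ⟨v, h⟩, n, q, ?_, ?_, ?_, ?_, ?_, ?_, ?_,
    ?_, ?_, ?_⟩
  · intro v
    by_cases h1 : IsLeaf T v
    · exact Or.inl h1
    by_cases h2 : IsLeaf H ⟨v, h1⟩
    · exact Or.inr (Or.inl ⟨h1, h2⟩)
    obtain ⟨i, hi⟩ := q'_surj _ h2
    refine Or.inr (Or.inr ⟨i.val, Nat.le_of_lt_succ i.isLt, ?_⟩)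
    rw [hq i.val (Nat.le_of_lt_succ i.isLt)]
    exact congrArg Subtype.val hi
  · exact fun v h => h.1
  · intro i hi
    rw [hq i hi]
    exact (q' _).2
  · rintro i hi ⟨h1, h2⟩
    refine q'_leaf ⟨i, Nat.lt_succ_of_le hi⟩ ?_
    convert h2 using 1
    exact Subtype.ext (hq i hi).symm
  · intro i hi j hj h
    rw [hq i hi, hq j hj] at h
    exact congrArg Fin.val (q'_inj (Subtype.val_injective h))
  · intro i hi j hj
    rw [hq i hi, hq j hj, ← hHadj, q'_adj]
  · exact fun v hv => hv.exists_neighbor hTt.connected hcardV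
  · rintro v ⟨h1, h2⟩
    obtain ⟨i, hi⟩ := hM _ h2
    refine ⟨i.val, Nat.le_of_lt_succ i.isLt, fun w hw => ?_⟩
    rw [hq i.val (Nat.le_of_lt_succ i.isLt)]
    exact (hi ⟨w, hw⟩).trans Subtype.ext_iff
  -- Such a vertex has two neighbors in `T` but only one in `H`.
  · rintro v ⟨h1, h2⟩
    obtain ⟨i, hi⟩ := hM _ h2
    obtain ⟨a, b, hab, ha, hb⟩ := exists_two_neighbors hTt.connected h1
    by_cases h3 : IsLeaf T a
    · exact ⟨a, h3, ha.symm⟩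
    by_cases h4 : IsLeaf T b
    · exact ⟨b, h4, hb.symm⟩
    have h5 := ((hi ⟨a, h3⟩).1 ha).trans ((hi ⟨b, h4⟩).1 hb).symm
    exact absurd (congrArg Subtype.val h5) hab
  · obtain ⟨a, b, hab, ha, hb, ha', hb'⟩ := ends
    refine ⟨a.1, b.1, fun h => hab (Subtype.ext h), ⟨a.2, ha⟩, ⟨b.2, hb⟩, ?_, ?_⟩
    · rw [hq 0 (Nat.zero_le n)]; exact ha'
    · rw [hq n le_rfl]; exact hb'

end AntimagicOrientation

/-! ### Rooting the lobster. -/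

theorem theorem1 {V : Type*} [Fintype V] (T : SimpleGraph V)
    (hT : AntimagicOrientation.IsLobster T) :
    AntimagicOrientation.HasAntimagicOrientation T := by
  classical
  obtain ⟨L, M, n, q, hcases, M_L, q_L, q_M, q_inj, q_adj, hL, hM, hMc, w₀, w₁, hw, hw₀, hw₁,
    hadj₀, hadj₁⟩ := hT.exists_layers
  -- Starting at `w₀` makes everything hanging off `p 0` a leaf, while `w₁ ≠ w₀` stays off the spine
  -- and puts a branch of length two at the root `q n`.
  let p : ℕ → V := fun i => if i = 0 then w₀ else q (i - 1)
  have p_zero : p 0 = w₀ := rfl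
  have p_succ : ∀ i, p (i + 1) = q i := fun _ => rfl
  have p_inj : Set.InjOn p (Set.Iic (n + 1)) := by
    intro i hi j hj hij
    rw [Set.mem_Iic] at hi hj
    rcases i with _ | i <;> rcases j with _ | j
    · rfl
    · rw [p_zero, p_succ] at hij
      exact absurd (hij ▸ hw₀) (q_M j (by omega))
    · rw [p_zero, p_succ] at hij
      exact absurd (hij ▸ hw₀) (q_M i (by omega))
    · rw [p_succ, p_succ] at hij
      rw [q_inj i (by omega) j (by omega) hij]
  obtain ⟨idx, hidx⟩ : ∃ idx : V → ℕ, ∀ i ≤ n + 1, idx (p i) = i :=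
    ⟨Function.invFunOn p (Set.Iic (n + 1)), fun i hi => p_inj.leftInvOn_invFunOn hi⟩
  obtain ⟨par, hpar⟩ : ∃ par : V → V, ∀ v,
      (L v → ¬ L (par v) ∧ ∀ w, T.Adj v w ↔ w = par v) ∧
      (M v → ∃ i ≤ n, par v = q i ∧ ∀ w, ¬ L w → (T.Adj v w ↔ w = q i)) ∧
      (∀ i < n, v = q i → par v = q (i + 1)) := by
    refine Classical.axiomOfChoice (r := fun v u =>
      (L v → ¬ L u ∧ ∀ w, T.Adj v w ↔ w = u) ∧
      (M v → ∃ i ≤ n, u = q i ∧ ∀ w, ¬ L w → (T.Adj v w ↔ w = q i)) ∧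
      (∀ i < n, v = q i → u = q (i + 1))) fun v => ?_
    rcases hcases v with h | h | ⟨i, hi, rfl⟩
    · obtain ⟨u, hu⟩ := hL v h
      exact ⟨u, fun _ => hu, fun h' => absurd h (M_L v h'),
        fun i hi h' => absurd (h' ▸ h) (q_L i hi.le)⟩
    · obtain ⟨i, hi, hu⟩ := hM v h
      exact ⟨q i, fun h' => absurd h' (M_L v h), fun _ => ⟨i, hi, rfl, hu⟩,
        fun j hj h' => absurd (h' ▸ h) (q_M j hj.le)⟩
    · refine ⟨q (i + 1), fun h => absurd h (q_L i hi), fun h => absurd h (q_M i hi),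
        fun j hj h => ?_⟩
      rw [q_inj i hi j hj.le h]
  have par_L : ∀ v w, L v → T.Adj v w → par v = w := fun v w hv h =>
    ((((hpar v).1 hv).2 w).1 h).symm
  have par_M : ∀ v w, M v → ¬ L w → T.Adj v w → par v = w := fun v w hv hw h => by
    obtain ⟨i, hi, h1, h2⟩ := (hpar v).2.1 hv
    rw [h1, (h2 w hw).1 h]
  have par_M' : ∀ v, M v → ∃ i ≤ n, par v = q i := fun v hv => by
    obtain ⟨i, hi, h1, -⟩ := (hpar v).2.1 hv
    exact ⟨i, hi, h1⟩
  have par_q : ∀ i < n, par (q i) = q (i + 1) := fun i hi => (hpar _).2.2 i hi rfl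
  obtain ⟨Sp, hSp⟩ : ∃ Sp : V → Prop, ∀ v, Sp v ↔ ∃ i ≤ n + 1, p i = v :=
    ⟨_, fun _ => Iff.rfl⟩
  have Sp_q : ∀ i ≤ n, Sp (q i) := fun i hi => (hSp _).2 ⟨i + 1, by omega, rfl⟩
  have nSp : ∀ v, ¬ Sp v → L v ∨ M v := fun v hv => by
    rcases hcases v with h | h | ⟨i, hi, rfl⟩
    · exact Or.inl h
    · exact Or.inr h
    · exact absurd (Sp_q i hi) hv
  have Sp_cases : ∀ v, Sp v → v = w₀ ∨ ∃ i ≤ n, q i = v := by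
    intro v hv
    obtain ⟨i, hi, rfl⟩ := (hSp v).1 hv
    rcases i with _ | i
    · exact Or.inl rfl
    · exact Or.inr ⟨i, by omega, rfl⟩
  have L_nSp : ∀ v, L v → ¬ Sp v := by
    intro v hv h
    rcases Sp_cases v h with rfl | ⟨i, hi, rfl⟩
    · exact M_L _ hw₀ hv
    · exact q_L i hi hv
  have par_nL : ∀ v, L v ∨ M v → ¬ L (par v) := by
    rintro v (hv | hv)
    · exact ((hpar v).1 hv).1
    · obtain ⟨i, hi, h⟩ := par_M' v hv
      rw [h]; exact q_L i hi
  obtain ⟨up, l, h1, h2, h3, h4⟩ :=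
    AntimagicOrientation.exists_antimagic_labels (n + 1) p par idx Sp hSp hidx
    (by
      intro i hi
      rcases i with _ | i
      · exact par_M _ _ hw₀ (q_L 0 (Nat.zero_le n)) hadj₀
      · exact par_q i (by omega))
    (by
      rintro u c hu hc rfl
      rcases nSp _ hu with h | h
      · exact absurd h (par_nL c (nSp c hc))
      · obtain ⟨i, hi, h'⟩ := par_M' _ h
        rw [h']; exact Sp_q i hi)
    (by
      obtain ⟨c, hc, hc'⟩ := hMc w₀ hw₀
      exact ⟨c, L_nSp c hc, par_L c _ hc hc'⟩)
    (by
      rintro c hc hc0 d hd rfl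
      rcases nSp _ hc with h | h
      · exact par_nL d (nSp d hd) h
      · obtain ⟨i, hi, h'⟩ := par_M' _ h
        rw [h', p_zero] at hc0
        exact q_M i hi (hc0 ▸ hw₀))
    (by
      obtain ⟨c, hc, hc'⟩ := hMc w₁ hw₁
      refine ⟨w₁, fun h => ?_, par_M _ _ hw₁ (q_L n le_rfl) hadj₁, c, L_nSp c hc,
        par_L c _ hc hc'⟩
      rcases Sp_cases _ h with h | ⟨i, hi, h⟩
      · exact hw h.symm
      · exact q_M i hi (h ▸ hw₁))
  have ne_root : ∀ v, L v ∨ M v → v ≠ p (n + 1) := by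
    rintro v (hv | hv) rfl
    · exact q_L n le_rfl hv
    · exact q_M n le_rfl hv
  refine AntimagicOrientation.hasAntimagicOrientation_of_parent T (p (n + 1)) par
    -- A rank falling strictly towards the root; it equals `n - i` at `q i`, whose index is `i + 1`.
    (fun v => if L v then n + 2 else if M v then n + 1 else n + 1 - idx v) ?_ ?_ up l h1 h2 h3 h4
  · have dq : ∀ i ≤ n, (if L (q i) then n + 2 else if M (q i) then n + 1 else
        n + 1 - idx (q i)) = n - i := by
      intro i hi
      rw [if_neg (q_L i hi), if_neg (q_M i hi), ← p_succ, hidx (i + 1) (by omega)]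
      omega
    intro v hv
    rcases hcases v with h | h | ⟨i, hi, rfl⟩
    · simp only [if_pos h, if_neg (par_nL v (Or.inl h))]
      split_ifs <;> omega
    · obtain ⟨i, hi, h'⟩ := par_M' v h
      simp only [h', dq i hi, if_neg (M_L v h), if_pos h]
      omega
    · have hi' : i < n := lt_of_le_of_ne hi fun h => hv (by rw [h]; rfl)
      simp only [par_q i hi', dq i hi, dq (i + 1) hi']
      omega
  · intro a b
    constructor
    · intro h
      by_cases ha : L a
      · exact Or.inl ⟨ne_root a (Or.inl ha), par_L a b ha h⟩
      by_cases hb : L b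
      · exact Or.inr ⟨ne_root b (Or.inl hb), par_L b a hb h.symm⟩
      rcases hcases a with ha' | ha' | ⟨i, hi, rfl⟩
      · exact absurd ha' ha
      · exact Or.inl ⟨ne_root a (Or.inr ha'), par_M a b ha' hb h⟩
      rcases hcases b with hb' | hb' | ⟨j, hj, rfl⟩
      · exact absurd hb' hb
      · exact Or.inr ⟨ne_root b (Or.inr hb'), par_M b _ hb' ha h.symm⟩
      have q_ne : ∀ k < n, q k ≠ p (n + 1) := fun k hk h => by
        have := q_inj k hk.le n le_rfl h
        omega
      rcases (q_adj i hi j hj).1 h with rfl | rfl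
      · exact Or.inl ⟨q_ne i (by omega), par_q i (by omega)⟩
      · exact Or.inr ⟨q_ne j (by omega), par_q j (by omega)⟩
    · have hback : ∀ v, v ≠ p (n + 1) → T.Adj v (par v) := by
        intro v hv
        rcases hcases v with h | h | ⟨i, hi, rfl⟩
        · exact (((hpar v).1 h).2 _).2 rfl
        · obtain ⟨i, hi, h1, h2⟩ := (hpar v).2.1 h
          rw [h1]
          exact (h2 _ (q_L i hi)).2 rfl
        · have hi' : i < n := lt_of_le_of_ne hi fun h => hv (by rw [h]; rfl)
          rw [par_q i hi']
          exact (q_adj i hi (i + 1) hi').2 (Or.inl rfl)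
      rintro (⟨h, rfl⟩ | ⟨h, rfl⟩)
      · exact hback a h
      · exact (hback b h).symm
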